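/- **Setting.** Consider a Bayesian bandit problem with action space $\mathcal A$ and parameter space $\mathcal O$ (standard Borel spaces, possibly infinite). The parameter $\Theta$ has a given prior law, and playing $a$ in the environment $\theta$ yields a random real reward $R(a,\theta)$ of finite mean, whose randomness is fresh in every round. Let $\pi_\star:\mathcal O\to\mathcal A$ be a measurable map with $\pi_\star(\theta)\in\operatorname{argmax}_a\mathbb E[R(a,\theta)]$, and let $A^\star=\pi_\star(\Theta)$. Thompson Sampling runs for $T$ rounds: at round $t$, given the history $H^t=(A_s,R_s)_{s<t}$, it draws $\hat\Theta_t$ from the posterior law of $\Theta$ given $H^t$, conditionally independently of $\Theta$, plays $A_t=\hat A_t=\pi_\star(\hat\Theta_t)$ and receives $R_t=R(A_t,\Theta)$. Write $R(A)$ for $R(A,\Theta)$ with the reward randomness of round $t$, $\mathbb E_t$ for expectation under the conditional law given $H^t$, and $\mathrm I_t(X;Y)$ for the Kullback–Leibler divergence of the conditional law of $(X,Y)$ given $H^t$ from the product of the conditional laws of $X$ and of $Y$ given $H^t$. Let $\varepsilon\in\mathbb R$ and let $\{\mathcal A_k\}_{k=1}^K$ be a finite measurable partition of $\mathcal A$ such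 that $\mathbb E[R(a,\theta)-R(a',\theta)]\le\varepsilon$ whenever $a,a'$ lie in the same cell and $\pi_\star(\theta)=a$. Let $A^\star_\varepsilon$ and $\hat A_{t,\varepsilon}$ be the indices of the cells containing $A^\star$ and $\hat A_t$. **Proposition.** Let $t\in\{1,\dots,T\}$ and suppose that $R(A^\star)$ and $R(A_t)$ are integrable. Then $A^\star_\varepsilon$ and $\hat A_{t,\varepsilon}$ are almost surely identically distributed conditionally on $H^t$, and there is a random function $\phi_t:\{1,\dots,K\}\to\mathcal A$, of the form $\phi_t(k)=\varphi(H^t,U,k)$ with $\varphi$ measurable and $U$ uniform on $[0,1]$ and independent of all the other variables (on the probability space extended by $U$), such that, with $\tilde A^\star_t=\phi_t(A^\star_\varepsilon)$ and $\tilde A_{t,\varepsilon}=\phi_t(\hat A_{t,\varepsilon})$, almost surely $\mathbb E_t|R(\tilde A^\star_t)|<\infty$, $\mathbb E_t|R(\tilde A_{t,\varepsilon})|<\infty$ and 1. $\mathbb E_t[R(A^\star)-R(A_t)]\le\varepsilon+\mathbb E_t[R(\tilde A^\star_t)-R(\tilde A_{t,\varepsilon})]$, 2. $\mathrm I_t\big(A^\star_\varepsilon;\tilde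 A_{t,\varepsilon},R(\tilde A_{t,\varepsilon})\big)\le \mathrm I_t\big(A^\star_\varepsilon;\hat A_t,R(\hat A_t)\big)$. -/

import Mathlib

open MeasureTheory ProbabilityTheory

namespace CompressedTS

/-- A Bayesian bandit problem with actions `𝒜` and parameters `𝒪`. The random reward function is
`R(a, θ) = reward a θ X` with reward noise `X ∼ noise`, so that the law of `reward a θ X` is the
reward distribution of action `a` in the environment `θ`. All expected rewards `E[R(a, θ)]` exist,
and `optAction θ` is an action of maximal expected reward in the environment `θ`. -/
structure Bandit (𝒜 𝒪 Ξ : Type*) [MeasurableSpace 𝒜] [MeasurableSpace 𝒪] [MeasurableSpace Ξ] where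
  prior : Measure 𝒪
  prior_prob : IsProbabilityMeasure prior
  noise : Measure Ξ
  noise_prob : IsProbabilityMeasure noise
  reward : 𝒜 → 𝒪 → Ξ → ℝ
  measurable_reward : Measurable fun p : 𝒜 × 𝒪 × Ξ => reward p.1 p.2.1 p.2.2
  integrable_reward : ∀ a θ, Integrable (reward a θ) noise
  optAction : 𝒪 → 𝒜
  measurable_optAction : Measurable optAction
  optAction_optimal : ∀ θ a,
    ∫ x, reward a θ x ∂noise ≤ ∫ x, reward (optAction θ) θ x ∂noise

section Conditioning

variable {Ω S E F : Type*} [MeasurableSpace Ω] [MeasurableSpace S]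
  [MeasurableSpace E] [StandardBorelSpace E] [Nonempty E]
  [MeasurableSpace F] [StandardBorelSpace F] [Nonempty F]

/-- `X` has a finite conditional expectation given `H = h`. -/
def CondIntegrable (P : Measure Ω) [IsFiniteMeasure P] (H : Ω → S) (X : Ω → ℝ) (h : S) : Prop :=
  Integrable (fun x : ℝ => x) (condDistrib X H P h)

/-- The conditional expectation `E[X | H = h]`, as the mean of the conditional law of `X`
given `H = h`. -/
noncomputable def condMean (P : Measure Ω) [IsFiniteMeasure P] (H : Ω → S) (X : Ω → ℝ)
    (h : S) : ℝ :=
  ∫ x, x ∂(condDistrib X H P h)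

/-- The disintegrated mutual information `I(X; Y)` given `H = h`: the Kullback–Leibler divergence
of the conditional joint law of `(X, Y)` from the product of its conditional marginals. -/
noncomputable def condMutualInfo (P : Measure Ω) [IsFiniteMeasure P] (H : Ω → S)
    (X : Ω → E) (Y : Ω → F) (h : S) : ENNReal :=
  InformationTheory.klDiv (condDistrib (fun ω => (X ω, Y ω)) H P h)
    ((condDistrib X H P h).prod (condDistrib Y H P h))

end Conditioning

namespace Bandit

variable {𝒜 𝒪 Ξ Ω : Type*} [MeasurableSpace 𝒜] [MeasurableSpace 𝒪] [MeasurableSpace Ξ]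

/-- The expected reward `E[R(a, θ)]`. -/
noncomputable def meanReward (B : Bandit 𝒜 𝒪 Ξ) (a : 𝒜) (θ : 𝒪) : ℝ :=
  ∫ x, B.reward a θ x ∂B.noise

/-- The cells `𝒜ₖ = {a | cell a = k}`, `k = 1, …, K`, form a partition of the action set such that
`E[R(a, θ) - R(a', θ)] ≤ ε` whenever `a, a'` are in the same cell and `θ = π⋆⁻¹(a)`. -/
def IsEpsPartition (B : Bandit 𝒜 𝒪 Ξ) {K : ℕ} (cell : 𝒜 → Fin K) (ε : ℝ) : Prop :=
  Measurable cell ∧ ∀ a a' : 𝒜, cell a = cell a' → ∀ θ : 𝒪, B.optAction θ = a →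
    B.meanReward a θ - B.meanReward a' θ ≤ ε

/-- The history `Hᵗ = (A_s, R_s)_{s < t}` when the sampled parameters are `Θhat s`, the
actions `A_s = π⋆(Θhat s)`, and the rewards `R_s = R(A_s, Θ)` with reward noise `ξ s`. -/
def history (B : Bandit 𝒜 𝒪 Ξ) {T : ℕ} (Θ : Ω → 𝒪) (Θhat : Fin T → Ω → 𝒪) (ξ : Fin T → Ω → Ξ)
    (t : Fin T) (ω : Ω) : Fin (t : ℕ) → 𝒜 × ℝ := fun i =>
  let s : Fin T := Fin.castLE t.isLt.le i
  (B.optAction (Θhat s ω), B.reward (B.optAction (Θhat s ω)) (Θ ω) (ξ s ω))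

/-- Thompson Sampling over `T` rounds: the parameter `Θ` has the prior law; at each round, given
the history and `Θ`, the estimate `Θhat t` is drawn from the posterior law of `Θ` given the
history, and the reward noise `ξ t` is a fresh copy of the noise. -/
structure IsThompsonSampling [StandardBorelSpace 𝒪] [Nonempty 𝒪] [MeasurableSpace Ω]
    (B : Bandit 𝒜 𝒪 Ξ) {T : ℕ} (P : Measure Ω) [IsProbabilityMeasure P]
    (Θ : Ω → 𝒪) (Θhat : Fin T → Ω → 𝒪) (ξ : Fin T → Ω → Ξ) : Prop where
  measurable_param : Measurable Θ
  measurable_estimate : ∀ t, Measurable (Θhat t)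
  measurable_noise : ∀ t, Measurable (ξ t)
  law_param : HasLaw Θ B.prior P
  posterior_sampling : ∀ t, HasCondDistrib (Θhat t)
    (fun ω => (B.history Θ Θhat ξ t ω, Θ ω))
    ((condDistrib Θ (B.history Θ Θhat ξ t) P).prodMkRight 𝒪) P
  law_noise : ∀ t, HasLaw (ξ t) B.noise P
  indep_noise : ∀ t, IndepFun (ξ t) (fun ω => (B.history Θ Θhat ξ t ω, Θ ω, Θhat t ω)) P

end Bandit

end CompressedTS

/-! Let `φ_t(k)` be an action drawn, with the seed `U`, from the posterior law of `A⋆` given that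
`A⋆` lies in cell `k`. Given the history, `Θ` and `Θhat` have the same posterior law, so drawing the
cell from `Θhat` and resampling inside it reproduces the law of the Thompson action. Moreover
`(Θhat, U)` is conditionally independent of `(Θ, ξ)`, so `AtildeEps` has the same joint law with
`(Θ, ξ)` as `Ahat`. Hence both have the same mean reward, and the information inequality is an
equality.

The regret bound then reduces to `E_t[R(A⋆) - R(Atilde)] ≤ ε`. Almost surely `Atilde` lies in the
cell of `A⋆`, so the defining property of the partition applies for each `(Θ, U)` after averaging
over the noise.

The conditional law of `(Θ, ξ, Θhat, U)` is identified in `map_history_round`, `φ_t` comes from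
`exists_resampling`, and the equality of laws is `roundLaw_map_resampled`. The delicate point is
integrability of `R(Atilde)`, whose action depends on `Θ` through its cell:
`integrable_resampled_optimal` deduces it from that of `R(AtildeEps)`, using that there are finitely
many cells. -/

namespace CompressedTS

open scoped ENNReal unitInterval

/-! ### Conditional laws as images of a disintegration, and a diagonal integrability bound. -/

section General

variable {Ω S E G : Type*} [MeasurableSpace Ω] [MeasurableSpace S] [MeasurableSpace G]
  [MeasurableSpace E] [StandardBorelSpace E] [Nonempty E]

/-- If `Z` has conditional law `η` given `H`, the conditional law of `f (H, Z)` given `H = h` is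
the image of `η h` under `f (h, ·)`. -/
theorem condDistrib_ae_eq_map_of_compProd {P : Measure Ω} [IsFiniteMeasure P]
    {H : Ω → S} {Z : Ω → G} {η : Kernel S G} [IsMarkovKernel η]
    (hH : Measurable H) (hZ : Measurable Z)
    (h : P.map (fun ω => (H ω, Z ω)) = P.map H ⊗ₘ η)
    {f : S → G → E} (hf : Measurable fun p : S × G => f p.1 p.2) :
    ∀ᵐ s ∂(P.map H), condDistrib (fun ω => f (H ω) (Z ω)) H P s = (η s).map (f s) := by
  -- Carrying `h` along through `Kernel.id` turns the family of images under `f h` into a single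
  -- measurable kernel.
  have key : condDistrib (fun ω => f (H ω) (Z ω)) H P =ᵐ[P.map H]
      (Kernel.id ×ₖ η).map (fun p : S × G => f p.1 p.2) := by
    have := Kernel.IsMarkovKernel.map (Kernel.id ×ₖ η) hf
    refine condDistrib_ae_eq_of_measure_eq_compProd (Y := fun ω => f (H ω) (Z ω)) H
      (hf.comp (hH.prodMk hZ)).aemeasurable ?_
    have h1 : P.map (fun ω => (H ω, f (H ω) (Z ω)))
        = (P.map (fun ω => (H ω, Z ω))).map (fun p => (p.1, f p.1 p.2)) := by
      rw [Measure.map_map (measurable_fst.prodMk hf) (hH.prodMk hZ)]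
      rfl
    rw [h1, h]
    refine Measure.ext_of_lintegral _ fun g hg => ?_
    rw [lintegral_map hg (measurable_fst.prodMk hf), Measure.lintegral_compProd hg]
    refine (Measure.lintegral_compProd (hg.comp (measurable_fst.prodMk hf))).trans
      (lintegral_congr fun s => ?_)
    have hgs : Measurable fun e => g (s, e) := hg.comp measurable_prodMk_left
    rw [Kernel.lintegral_map _ hf _ hgs]
    exact (Kernel.lintegral_id_prod (hgs.comp hf) η s).symm
  filter_upwards [key] with s hs
  have hfs : Measurable (f s) := hf.comp measurable_prodMk_left
  rw [hs]
  refine Measure.ext_of_lintegral _ fun g hg => ?_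
  rw [Kernel.lintegral_map _ hf _ hg, lintegral_map hg hfs]
  exact Kernel.lintegral_id_prod (hg.comp hf) η s

/-- The conditional law, on an extension of the probability space, of a function of `H` and of
variables with conditional law `η` given `H`. -/
theorem condDistrib_prod_ae_eq_map {U : Type*} [MeasurableSpace U] {P : Measure Ω}
    [IsProbabilityMeasure P] {ν : Measure U} [IsProbabilityMeasure ν] {H : Ω → S} {Z : Ω × U → G}
    {η : Kernel S G} [IsMarkovKernel η] (hH : Measurable H) (hZ : Measurable Z)
    (h : (P.prod ν).map (fun p => (H p.1, Z p)) = P.map H ⊗ₘ η)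
    {f : S → G → E} (hf : Measurable fun p : S × G => f p.1 p.2) :
    ∀ᵐ s ∂(P.map H), condDistrib (fun p : Ω × U => f (H p.1) (Z p)) (fun p => H p.1) (P.prod ν) s
      = (η s).map (f s) := by
  have hmap : (P.prod ν).map (fun p => H p.1) = P.map H := by
    have : (fun p : Ω × U => H p.1) = H ∘ Prod.fst := rfl
    rw [this, ← Measure.map_map hH measurable_fst, Measure.map_fst_prod]
    simp
  have h1 := condDistrib_ae_eq_map_of_compProd (hH.comp measurable_fst) hZ
    (h.trans (by rw [← hmap]; rfl)) hf
  rwa [← hmap]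

/-- The conditional law of a variable that is, on an extension of the probability space, a function
of `H` and of variables with conditional law `η` given `H`. -/
theorem condDistrib_ae_eq_map_of_prod {U : Type*} [MeasurableSpace U] {P : Measure Ω}
    [IsProbabilityMeasure P] {ν : Measure U} [IsProbabilityMeasure ν] {H : Ω → S} {Z : Ω × U → G}
    {η : Kernel S G} [IsMarkovKernel η] (hH : Measurable H) (hZ : Measurable Z)
    (h : (P.prod ν).map (fun p => (H p.1, Z p)) = P.map H ⊗ₘ η)
    {f : S → G → E} (hf : Measurable fun p : S × G => f p.1 p.2)
    {Y : Ω → E} (hY : Measurable Y) (hfY : ∀ p, f (H p.1) (Z p) = Y p.1) :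
    ∀ᵐ s ∂(P.map H), condDistrib Y H P s = (η s).map (f s) := by
  -- Adjoining an independent seed leaves the conditional law of `Y` unchanged.
  filter_upwards [condDistrib_prod_ae_eq_map hH hZ h hf,
    condDistrib_fst_prod H hY.aemeasurable ν] with s h1 h2
  rw [← h1, ← h2]
  simp only [hfY]

/-- A nonnegative function of `θ` and an independent copy of the label `q θ` that has a finite
integral still has one if the label is that of `θ`. -/
theorem lintegral_diagonal_lt_top {ι Y : Type*} [Fintype ι] [MeasurableSpace ι]
    [MeasurableSingletonClass ι] [MeasurableSpace Y]
    (μ : Measure G) [SFinite μ] (ρ : Measure Y) [SFinite ρ] {q : G → ι} (hq : Measurable q)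
    {f : G × Y × ι → ℝ≥0∞} (hf : Measurable f)
    (hfin : ∫⁻ x, ∫⁻ x', ∫⁻ y, f (x, y, q x') ∂ρ ∂μ ∂μ < ∞) :
    ∫⁻ x, ∫⁻ y, f (x, y, q x) ∂ρ ∂μ < ∞ := by
  classical
  set g : G → ι → ℝ≥0∞ := fun x k => ∫⁻ y, f (x, y, k) ∂ρ with hg_def
  have hg : Measurable fun p : G × ι => g p.1 p.2 := by
    have : Measurable fun p : (G × ι) × Y => f (p.1.1, p.2, p.1.2) := by fun_prop
    exact this.lintegral_prod_right'
  have hgk (k : ι) : Measurable fun x => g x k := hg.comp measurable_prodMk_right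
  -- `J k` freezes the label at `k`. It may be infinite only at labels of measure zero; the finitely
  -- many remaining values sum to a bound for the diagonal integral.
  set J : ι → ℝ≥0∞ := fun k => ∫⁻ x, g x k ∂μ with hJ_def
  have hswap : ∫⁻ x', J (q x') ∂μ < ∞ := by
    rw [lintegral_lintegral_swap] at hfin
    · exact hfin
    · exact (hg.comp (measurable_fst.prodMk (hq.comp measurable_snd))).aemeasurable
  have hJm : Measurable fun x' => J (q x') := (measurable_of_countable J).comp hq
  have hae : ∀ᵐ x' ∂μ, J (q x') < ∞ := ae_lt_top hJm hswap.ne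
  calc ∫⁻ x, g x (q x) ∂μ
      ≤ ∫⁻ x, ∑ k with J k < ∞, g x k ∂μ := by
        refine lintegral_mono_ae ?_
        filter_upwards [hae] with x hx
        exact Finset.single_le_sum (f := fun k => g x k) (fun _ _ => zero_le)
          (Finset.mem_filter.2 ⟨Finset.mem_univ _, hx⟩)
    _ = ∑ k with J k < ∞, J k := lintegral_finsetSum _ fun k _ => hgk k
    _ < ∞ := ENNReal.sum_lt_top.2 fun k hk => (Finset.mem_filter.1 hk).2

end General

/-! ### Resampling an action from its cell with a uniform seed. -/

section Resampling

variable {S 𝒜 G ι : Type*} [MeasurableSpace S] [MeasurableSpace G]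
  [MeasurableSpace 𝒜] [StandardBorelSpace 𝒜] [Nonempty 𝒜]
  [Countable ι] [MeasurableSpace ι] [MeasurableSingletonClass ι]

/-- Given a kernel `κ`, there is a measurable function `φ` with a uniform seed such that
`φ s U (c (π θ))` has, jointly with the label `c (π θ)`, the law of `π θ` when `θ ∼ κ s`. -/
theorem exists_resampling (κ : Kernel S G) [IsMarkovKernel κ] {π : G → 𝒜} (hπ : Measurable π)
    {c : 𝒜 → ι} (hc : Measurable c) :
    ∃ φ : S → I → ι → 𝒜, Measurable (fun q : S × I × ι => φ q.1 q.2.1 q.2.2) ∧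
      ∀ s, ((κ s).prod volume).map (fun p => (c (π p.1), φ s p.2 (c (π p.1))))
        = (κ s).map (fun θ => (c (π θ), π θ)) := by
  have hm : Measurable fun θ => (c (π θ), π θ) := by fun_prop
  let ρ : Kernel S (ι × 𝒜) := κ.map fun θ => (c (π θ), π θ)
  have : IsMarkovKernel ρ := Kernel.IsMarkovKernel.map κ hm
  -- `ρ.condKernel (s, k)` is the law of the action given its label `k`; it is realised as the image
  -- of the uniform law. Its values at labels of mass zero are arbitrary and play no role.
  obtain ⟨f, hf, hfmap⟩ := Kernel.exists_measurable_map_eq_unitInterval ρ.condKernel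
  have hf' : Measurable fun q : S × I × ι => f (q.1, q.2.2) q.2.1 :=
    hf.comp (f := fun q : S × I × ι => ((q.1, q.2.2), q.2.1)) (by fun_prop)
  refine ⟨fun s u k => f (s, k) u, hf', fun s => ?_⟩
  have hfs : Measurable fun q : I × ι => f (s, q.2) q.1 := hf'.comp measurable_prodMk_left
  have hfc : Measurable fun p : G × I => (c (π p.1), f (s, c (π p.1)) p.2) :=
    (hc.comp (hπ.comp measurable_fst)).prodMk
      (hfs.comp (f := fun p : G × I => (p.2, c (π p.1))) (by fun_prop))
  refine Measure.ext_of_lintegral _ fun g hg => ?_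
  have hfk (k : ι) : Measurable (f (s, k)) := hf.comp measurable_prodMk_left
  have hgk (k : ι) : Measurable fun a => g (k, a) := hg.comp measurable_prodMk_left
  have hin (k : ι) : ∫⁻ u, g (k, f (s, k) u) = ∫⁻ a, g (k, a) ∂(ρ.condKernel (s, k)) := by
    rw [← hfmap, lintegral_map (hgk k) (hfk k)]
  rw [lintegral_map hg hfc]
  refine (lintegral_prod _ (hg.comp hfc).aemeasurable).trans ?_
  simp only [Function.comp_apply, hin]
  have hρ : (κ s).map (fun θ => (c (π θ), π θ)) = ρ s := (Kernel.map_apply _ hm _).symm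
  have hfst : ρ.fst s = (κ s).map fun θ => c (π θ) := by
    rw [Kernel.fst_apply, ← hρ, Measure.map_map measurable_fst hm]
    rfl
  rw [hρ, ← lintegral_condKernel hg s, hfst, lintegral_map (measurable_of_countable _)
    (by fun_prop : Measurable fun θ => c (π θ))]

end Resampling

/-- The histories of `n` rounds. -/
abbrev HistorySpace (𝒜 : Type*) (n : ℕ) := Fin n → 𝒜 × ℝ

/-- The values of the parameter, the reward noise, the estimate and the seed of a round. -/
abbrev RoundSpace (𝒪 Ξ : Type*) := 𝒪 × Ξ × 𝒪 × I

/-! ### The law of one round for a fixed history. -/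

section Round

variable {𝒜 𝒪 Ξ : Type*} [MeasurableSpace 𝒜] [MeasurableSpace 𝒪] [MeasurableSpace Ξ]
  {K : ℕ}

/-- The joint law of `(Θ, ξ, Θhat, U)` when `Θ` and `Θhat` have the posterior law `μ`. -/
noncomputable def roundLaw (μ : Measure 𝒪) (ν : Measure Ξ) : Measure (𝒪 × Ξ × 𝒪 × I) :=
  μ.prod (ν.prod (μ.prod volume))

instance (μ : Measure 𝒪) (ν : Measure Ξ) [IsProbabilityMeasure μ] [IsProbabilityMeasure ν] :
    IsProbabilityMeasure (roundLaw μ ν) := by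
  unfold roundLaw; infer_instance

variable {μ : Measure 𝒪} [IsProbabilityMeasure μ] {ν : Measure Ξ} [IsProbabilityMeasure ν]

theorem roundLaw_map_param : (roundLaw μ ν).map (fun z => z.1) = μ := by
  simp [roundLaw, Measure.map_fst_prod]

theorem roundLaw_map_estimate : (roundLaw μ ν).map (fun z => z.2.2.1) = μ := by
  have h : (fun z : 𝒪 × Ξ × 𝒪 × I => z.2.2.1) = Prod.fst ∘ Prod.snd ∘ Prod.snd := rfl
  rw [h, ← Measure.map_map (by fun_prop) (by fun_prop),
    ← Measure.map_map (by fun_prop) (by fun_prop)]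
  simp [roundLaw, Measure.map_snd_prod, Measure.map_fst_prod]

/-- This drops the estimate and puts the noise last, so that Fubini can average over the noise with
parameter and seed fixed. -/
theorem roundLaw_map_param_seed_noise :
    (roundLaw μ ν).map (fun z => ((z.1, z.2.2.2), z.2.1)) = (μ.prod volume).prod ν := by
  refine Measure.ext_of_lintegral _ fun g hg => ?_
  have hm : Measurable fun z : 𝒪 × Ξ × 𝒪 × I => ((z.1, z.2.2.2), z.2.1) := by fun_prop
  rw [lintegral_map hg hm, lintegral_prod _ hg.aemeasurable,
    lintegral_prod _ hg.lintegral_prod_right'.aemeasurable]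
  refine (lintegral_prod _ (hg.comp hm).aemeasurable).trans (lintegral_congr fun θ => ?_)
  have h1 : Measurable fun y : Ξ × 𝒪 × I => g ((θ, y.2.2), y.1) := by fun_prop
  have h2 (x : Ξ) : Measurable fun y : 𝒪 × I => g ((θ, y.2), x) := by fun_prop
  refine (lintegral_prod _ h1.aemeasurable).trans ?_
  have h3 : Measurable fun y : Ξ × I => g ((θ, y.2), y.1) := by fun_prop
  calc ∫⁻ x, ∫⁻ y, g ((θ, y.2), x) ∂(μ.prod volume) ∂ν
      = ∫⁻ x, ∫⁻ u : I, g ((θ, u), x) ∂volume ∂ν := lintegral_congr fun x => by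
        rw [lintegral_prod _ (h2 x).aemeasurable]
        simp
    _ = _ := lintegral_lintegral_swap h3.aemeasurable

variable {π : 𝒪 → 𝒜} {c : 𝒜 → Fin K} {ψ : I → Fin K → 𝒜}

/-- Resampling the action within its cell does not change its joint law with the parameter and
the reward noise. -/
theorem roundLaw_map_resampled (hπ : Measurable π) (hc : Measurable c)
    (hψ : Measurable fun q : I × Fin K => ψ q.1 q.2)
    (hlaw : (μ.prod volume).map (fun p => (c (π p.1), ψ p.2 (c (π p.1))))
      = μ.map fun θ => (c (π θ), π θ))
    {E : Type*} [MeasurableSpace E] {f : 𝒪 × Ξ × 𝒜 → E} (hf : Measurable f) :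
    (roundLaw μ ν).map (fun z => f (z.1, z.2.1, ψ z.2.2.2 (c (π z.2.2.1))))
      = (roundLaw μ ν).map (fun z => f (z.1, z.2.1, π z.2.2.1)) := by
  have hψm : Measurable fun p : 𝒪 × I => ψ p.2 (c (π p.1)) :=
    hψ.comp (f := fun p : 𝒪 × I => (p.2, c (π p.1))) (by fun_prop)
  have hπm : Measurable fun p : 𝒪 × I => π p.1 := by fun_prop
  -- Only the action marginal of `hlaw` is needed, since the estimate and seed are independent of
  -- the parameter and noise.
  have h1 : (μ.prod (volume : Measure I)).map (fun p => ψ p.2 (c (π p.1)))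
      = (μ.prod (volume : Measure I)).map (fun p => π p.1) := by
    have h2 := congrArg (Measure.map Prod.snd) hlaw
    rw [Measure.map_map measurable_snd (by fun_prop),
      Measure.map_map measurable_snd (by fun_prop)] at h2
    refine h2.trans ?_
    have : (fun p : 𝒪 × I => π p.1) = π ∘ Prod.fst := rfl
    rw [this, ← Measure.map_map hπ measurable_fst, Measure.map_fst_prod]
    simp [Function.comp_def]
  have key {g : 𝒪 × I → 𝒜} (hg : Measurable g) :
      (roundLaw μ ν).map (fun z => f (z.1, z.2.1, g z.2.2))
        = (μ.prod (ν.prod ((μ.prod volume).map g))).map f := by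
    have := Measure.isProbabilityMeasure_map (μ := μ.prod (volume : Measure I)) hg.aemeasurable
    calc _ = ((roundLaw μ ν).map (Prod.map id (Prod.map id g))).map f :=
        (Measure.map_map hf (measurable_id.prodMap (measurable_id.prodMap hg))).symm
      _ = _ := by
        rw [roundLaw, ← Measure.map_prod_map _ _ measurable_id (measurable_id.prodMap hg),
          ← Measure.map_prod_map _ _ measurable_id hg, Measure.map_id, Measure.map_id]
  rw [key hψm, key hπm, h1]

omit [IsProbabilityMeasure μ] in
/-- The resampled action stays in its cell. -/
theorem ae_cell_resampled (hπ : Measurable π) (hc : Measurable c)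
    (hψ : Measurable fun q : I × Fin K => ψ q.1 q.2)
    (hlaw : (μ.prod volume).map (fun p => (c (π p.1), ψ p.2 (c (π p.1))))
      = μ.map fun θ => (c (π θ), π θ)) :
    ∀ᵐ p ∂(μ.prod (volume : Measure I)), c (ψ p.2 (c (π p.1))) = c (π p.1) := by
  have hψm : Measurable fun p : 𝒪 × I => ψ p.2 (c (π p.1)) :=
    hψ.comp (f := fun p : 𝒪 × I => (p.2, c (π p.1))) (by fun_prop)
  have hs : MeasurableSet {q : Fin K × 𝒜 | c q.2 = q.1} :=
    measurableSet_eq_fun (hc.comp measurable_snd) measurable_fst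
  -- For the original action the label matches by definition; the equality of laws transfers this to
  -- the resampled one.
  have h1 : ∀ᵐ q ∂(μ.map fun θ => (c (π θ), π θ)), c q.2 = q.1 := by
    rw [ae_map_iff (by fun_prop) hs]
    exact Filter.Eventually.of_forall fun _ => rfl
  rw [← hlaw, ae_map_iff (by fun_prop) hs] at h1
  exact h1

variable {r : 𝒜 → 𝒪 → Ξ → ℝ}

/-- The reward of the action resampled from the cell of the optimal action is integrable. -/
theorem integrable_resampled_optimal (hπ : Measurable π) (hc : Measurable c)
    (hψ : Measurable fun q : I × Fin K => ψ q.1 q.2)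
    (hr : Measurable fun p : 𝒜 × 𝒪 × Ξ => r p.1 p.2.1 p.2.2)
    (hint : Integrable (fun z => r (ψ z.2.2.2 (c (π z.2.2.1))) z.1 z.2.1) (roundLaw μ ν)) :
    Integrable (fun z => r (ψ z.2.2.2 (c (π z.1))) z.1 z.2.1) (roundLaw μ ν) := by
  have hf : Measurable fun y : 𝒪 × (Ξ × I) × Fin K => ‖r (ψ y.2.1.2 y.2.2) y.1 y.2.1.1‖ₑ := by
    have h1 : Measurable fun y : 𝒪 × (Ξ × I) × Fin K => ψ y.2.1.2 y.2.2 :=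
      hψ.comp (f := fun y : 𝒪 × (Ξ × I) × Fin K => (y.2.1.2, y.2.2)) (by fun_prop)
    exact (hr.comp (h1.prodMk (by fun_prop :
      Measurable fun y : 𝒪 × (Ξ × I) × Fin K => (y.1, y.2.1.1)))).enorm
  have hf0 : Measurable fun z : 𝒪 × Ξ × 𝒪 × I => r (ψ z.2.2.2 (c (π z.1))) z.1 z.2.1 := by
    have h1 : Measurable fun z : 𝒪 × Ξ × 𝒪 × I => ψ z.2.2.2 (c (π z.1)) :=
      hψ.comp (f := fun z : 𝒪 × Ξ × 𝒪 × I => (z.2.2.2, c (π z.1))) (by fun_prop)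
    exact hr.comp (h1.prodMk (by fun_prop : Measurable fun z : 𝒪 × Ξ × 𝒪 × I => (z.1, z.2.1)))
  refine ⟨hf0.aestronglyMeasurable, ?_⟩
  have h2 := hint.2
  rw [hasFiniteIntegral_iff_enorm] at h2 ⊢
  -- Grouping noise and seed into one variable exposes the parameter and the estimate as two
  -- independent copies, the form required by `lintegral_diagonal_lt_top`.
  have hperm : ∀ g : 𝒪 × (Ξ × I) × 𝒪 → ℝ≥0∞, Measurable g →
      ∫⁻ z, g (z.1, (z.2.1, z.2.2.2), z.2.2.1) ∂(roundLaw μ ν)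
        = ∫⁻ θ, ∫⁻ θ', ∫⁻ y, g (θ, y, θ') ∂(ν.prod volume) ∂μ ∂μ := by
    intro g hg
    have m1 : Measurable fun z : 𝒪 × Ξ × 𝒪 × I => g (z.1, (z.2.1, z.2.2.2), z.2.2.1) := by fun_prop
    rw [roundLaw, lintegral_prod _ m1.aemeasurable]
    refine lintegral_congr fun θ => ?_
    have m2 : Measurable fun z : Ξ × 𝒪 × I => g (θ, (z.1, z.2.2), z.2.1) := by fun_prop
    have m3 (x : Ξ) : Measurable fun z : 𝒪 × I => g (θ, (x, z.2), z.1) := by fun_prop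
    have m4 (θ' : 𝒪) : Measurable fun y : Ξ × I => g (θ, y, θ') := by fun_prop
    have m5 : Measurable fun w : Ξ × 𝒪 => ∫⁻ u : I, g (θ, (w.1, u), w.2) := by
      have : Measurable fun w : (Ξ × 𝒪) × I => g (θ, (w.1.1, w.2), w.1.2) := by fun_prop
      exact this.lintegral_prod_right'
    rw [lintegral_prod _ m2.aemeasurable]
    calc _ = ∫⁻ x, ∫⁻ θ', ∫⁻ u : I, g (θ, (x, u), θ') ∂volume ∂μ ∂ν :=
          lintegral_congr fun x => lintegral_prod _ (m3 x).aemeasurable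
      _ = ∫⁻ θ', ∫⁻ x, ∫⁻ u : I, g (θ, (x, u), θ') ∂volume ∂ν ∂μ :=
          lintegral_lintegral_swap m5.aemeasurable
      _ = _ := lintegral_congr fun θ' => (lintegral_prod _ (m4 θ').aemeasurable).symm
  have e1 := hperm (fun w => ‖r (ψ w.2.1.2 (c (π w.2.2))) w.1 w.2.1.1‖ₑ)
    (hf.comp (f := fun w : 𝒪 × (Ξ × I) × 𝒪 => (w.1, w.2.1, c (π w.2.2))) (by fun_prop))
  have e2 := hperm (fun w => ‖r (ψ w.2.1.2 (c (π w.1))) w.1 w.2.1.1‖ₑ)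
    (hf.comp (f := fun w : 𝒪 × (Ξ × I) × 𝒪 => (w.1, w.2.1, c (π w.1))) (by fun_prop))
  rw [e1] at h2
  rw [e2]
  simpa using lintegral_diagonal_lt_top μ (ν.prod (volume : Measure I)) (hc.comp hπ) hf h2

end Round

/-! ### The cost of resampling the optimal action. -/

namespace Bandit

variable {𝒜 𝒪 Ξ : Type*} [MeasurableSpace 𝒜] [MeasurableSpace 𝒪] [MeasurableSpace Ξ]

/-- Replacing the optimal action by one resampled from its cell costs at most `ε`. -/
theorem integral_sub_resampled_le (B : Bandit 𝒜 𝒪 Ξ) {K : ℕ} {c : 𝒜 → Fin K} {ε : ℝ}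
    (hcell : B.IsEpsPartition c ε) (μ : Measure 𝒪) [IsProbabilityMeasure μ] {ψ : I → Fin K → 𝒜}
    (hψ : Measurable fun q : I × Fin K => ψ q.1 q.2)
    (hlaw : (μ.prod volume).map (fun p => (c (B.optAction p.1), ψ p.2 (c (B.optAction p.1))))
      = μ.map fun θ => (c (B.optAction θ), B.optAction θ))
    (hopt : Integrable (fun z => B.reward (B.optAction z.1) z.1 z.2.1) (roundLaw μ B.noise))
    (hres : Integrable (fun z => B.reward (ψ z.2.2.2 (c (B.optAction z.1))) z.1 z.2.1)
      (roundLaw μ B.noise)) :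
    ∫ z, (B.reward (B.optAction z.1) z.1 z.2.1
        - B.reward (ψ z.2.2.2 (c (B.optAction z.1))) z.1 z.2.1) ∂(roundLaw μ B.noise) ≤ ε := by
  have := B.noise_prob
  have hc := hcell.1
  have hπ := B.measurable_optAction
  set F : (𝒪 × I) × Ξ → ℝ := fun w => B.reward (B.optAction w.1.1) w.1.1 w.2
    - B.reward (ψ w.1.2 (c (B.optAction w.1.1))) w.1.1 w.2 with hF
  have hFm : Measurable F := by
    have h1 : Measurable fun w : (𝒪 × I) × Ξ => ψ w.1.2 (c (B.optAction w.1.1)) :=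
      hψ.comp (f := fun w : (𝒪 × I) × Ξ => (w.1.2, c (B.optAction w.1.1))) (by fun_prop)
    have h2 : Measurable fun w : (𝒪 × I) × Ξ => (w.1.1, w.2) := by fun_prop
    exact (B.measurable_reward.comp ((by fun_prop :
      Measurable fun w : (𝒪 × I) × Ξ => B.optAction w.1.1).prodMk h2)).sub
        (B.measurable_reward.comp (h1.prodMk h2))
  have hm : Measurable fun z : 𝒪 × Ξ × 𝒪 × I => ((z.1, z.2.2.2), z.2.1) := by fun_prop
  have hFi : Integrable F ((μ.prod volume).prod B.noise) := by
    rw [← roundLaw_map_param_seed_noise (μ := μ) (ν := B.noise),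
      integrable_map_measure hFm.aestronglyMeasurable hm.aemeasurable]
    exact hopt.sub hres
  calc ∫ z, F ((z.1, z.2.2.2), z.2.1) ∂(roundLaw μ B.noise)
      = ∫ w, F w ∂((μ.prod volume).prod B.noise) := by
        rw [← roundLaw_map_param_seed_noise (μ := μ) (ν := B.noise),
          integral_map hm.aemeasurable hFm.aestronglyMeasurable]
    _ = ∫ p, ∫ x, F (p, x) ∂B.noise ∂(μ.prod volume) := integral_prod _ hFi
    _ ≤ ∫ _, ε ∂(μ.prod (volume : Measure I)) := by
        refine integral_mono_ae hFi.integral_prod_left (integrable_const _) ?_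
        -- For almost every parameter and seed the two actions share a cell and the first is
        -- optimal, so the partition property bounds the noise average.
        filter_upwards [ae_cell_resampled hπ hc hψ hlaw] with p hp
        have := hcell.2 _ _ hp.symm p.1 rfl
        simpa only [hF, meanReward, integral_sub (B.integrable_reward _ _)
          (B.integrable_reward _ _)] using this
    _ = ε := by simp

/-! ### The conditional law of a round of Thompson Sampling given the history. -/

namespace IsThompsonSampling

variable {Ω : Type*} [MeasurableSpace Ω] [StandardBorelSpace 𝒪] [Nonempty 𝒪]
  {B : Bandit 𝒜 𝒪 Ξ} {T : ℕ} {P : Measure Ω} [IsProbabilityMeasure P] {Θ : Ω → 𝒪}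
  {Θhat : Fin T → Ω → 𝒪} {ξ : Fin T → Ω → Ξ}

theorem measurable_history (hTS : B.IsThompsonSampling P Θ Θhat ξ) (t : Fin T) :
    Measurable (B.history Θ Θhat ξ t) := by
  refine measurable_pi_lambda _ fun i => ?_
  have h1 := B.measurable_optAction.comp (hTS.measurable_estimate (Fin.castLE t.isLt.le i))
  exact h1.prodMk (B.measurable_reward.comp
    (h1.prodMk (hTS.measurable_param.prodMk (hTS.measurable_noise (Fin.castLE t.isLt.le i)))))

/-- Given the history, the parameter, the reward noise, the estimate and the seed are independent,
and the parameter and the estimate have the posterior law. -/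
theorem map_history_round (hTS : B.IsThompsonSampling P Θ Θhat ξ) (t : Fin T)
    (η : Kernel (Fin (t : ℕ) → 𝒜 × ℝ) (𝒪 × Ξ × 𝒪 × I)) [IsMarkovKernel η]
    (hη : ∀ h, η h = roundLaw (condDistrib Θ (B.history Θ Θhat ξ t) P h) B.noise) :
    (P.prod volume).map (fun p : Ω × I => (B.history Θ Θhat ξ t p.1,
      (Θ p.1, ξ t p.1, Θhat t p.1, p.2))) = P.map (B.history Θ Θhat ξ t) ⊗ₘ η := by
  have := B.noise_prob
  have hH := hTS.measurable_history t
  have hΘ := hTS.measurable_param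
  have hE := hTS.measurable_estimate t
  have hξ := hTS.measurable_noise t
  have hpost := (hTS.posterior_sampling t).map_eq
  have hind := (indepFun_iff_map_prod_eq_prod_map_map hξ.aemeasurable
    (hH.prodMk (hΘ.prodMk hE)).aemeasurable).1 (hTS.indep_noise t)
  rw [(hTS.law_noise t).map_eq] at hind
  set H := B.history Θ Θhat ξ t
  set κ := condDistrib Θ H P
  have hprior : P.map (fun ω => (H ω, Θ ω)) = P.map H ⊗ₘ κ :=
    (compProd_map_condDistrib hΘ.aemeasurable).symm
  refine Measure.ext_of_lintegral _ fun g hg => ?_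
  have hm : Measurable fun p : Ω × I => (H p.1, (Θ p.1, ξ t p.1, Θhat t p.1, p.2)) := by fun_prop
  set g₁ : Ξ × (Fin (t : ℕ) → 𝒜 × ℝ) × 𝒪 × 𝒪 → ℝ≥0∞ :=
    fun w => ∫⁻ u, g (w.2.1, (w.2.2.1, w.1, w.2.2.2, u)) with hg₁_def
  have hg₁ : Measurable g₁ := by
    have : Measurable fun w : (Ξ × (Fin (t : ℕ) → 𝒜 × ℝ) × 𝒪 × 𝒪) × I =>
      g (w.1.2.1, (w.1.2.2.1, w.1.1, w.1.2.2.2, w.2)) := by fun_prop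
    exact this.lintegral_prod_right'
  set g₂ : ((Fin (t : ℕ) → 𝒜 × ℝ) × 𝒪) × 𝒪 → ℝ≥0∞ :=
    fun w => ∫⁻ x, g₁ (x, w.1.1, w.1.2, w.2) ∂B.noise with hg₂_def
  have hg₂ : Measurable g₂ := by
    have : Measurable fun w : (((Fin (t : ℕ) → 𝒜 × ℝ) × 𝒪) × 𝒪) × Ξ =>
      g₁ (w.2, w.1.1.1, w.1.1.2, w.1.2) := by fun_prop
    exact this.lintegral_prod_right'
  have hg₃ : Measurable fun w : (Fin (t : ℕ) → 𝒜 × ℝ) × 𝒪 =>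
      ∫⁻ θ', g₂ (w, θ') ∂(κ w.1) := by
    have := Measurable.lintegral_kernel_prod_right' (κ := κ.prodMkRight 𝒪) hg₂
    simpa using this
  -- The seed, the noise, the estimate and the parameter are integrated out in this order, each
  -- being independent of, or having a known conditional law given, those still present. The noise
  -- and estimate are swapped at the end to match `roundLaw`.
  calc ∫⁻ a, g a ∂((P.prod volume).map fun p => (H p.1, (Θ p.1, ξ t p.1, Θhat t p.1, p.2)))
      = ∫⁻ ω, g₁ (ξ t ω, H ω, Θ ω, Θhat t ω) ∂P := by
        rw [lintegral_map hg hm]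
        exact lintegral_prod _ (hg.comp hm).aemeasurable
    _ = ∫⁻ w, g₁ w ∂(B.noise.prod (P.map fun ω => (H ω, Θ ω, Θhat t ω))) := by
        rw [← hind, lintegral_map hg₁ (by fun_prop)]
    _ = ∫⁻ ω, g₂ ((H ω, Θ ω), Θhat t ω) ∂P := by
        rw [lintegral_prod_symm _ hg₁.aemeasurable]
        exact lintegral_map (hg₂.comp (f := fun w : (Fin (t : ℕ) → 𝒜 × ℝ) × 𝒪 × 𝒪 =>
          ((w.1, w.2.1), w.2.2)) (by fun_prop)) (by fun_prop)
    _ = ∫⁻ w, ∫⁻ θ', g₂ (w, θ') ∂(κ w.1) ∂(P.map fun ω => (H ω, Θ ω)) := by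
        rw [← lintegral_map hg₂ (by fun_prop : Measurable fun ω => ((H ω, Θ ω), Θhat t ω)),
          hpost, Measure.lintegral_compProd hg₂]
        rfl
    _ = ∫⁻ h, ∫⁻ θ, ∫⁻ θ', g₂ ((h, θ), θ') ∂(κ h) ∂(κ h) ∂(P.map H) := by
        rw [hprior, Measure.lintegral_compProd hg₃]
    _ = ∫⁻ h, ∫⁻ z, g (h, z) ∂(η h) ∂(P.map H) := by
        refine lintegral_congr fun h => ?_
        have m1 : Measurable fun z => g (h, z) := by fun_prop
        rw [hη, roundLaw, lintegral_prod _ m1.aemeasurable]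
        refine lintegral_congr fun θ => ?_
        have m2 : Measurable fun z : Ξ × 𝒪 × I => g (h, θ, z) := by fun_prop
        have m3 (x : Ξ) : Measurable fun z : 𝒪 × I => g (h, θ, x, z) := by fun_prop
        have m4 : Measurable fun w : 𝒪 × Ξ => g₁ (w.2, h, θ, w.1) := by fun_prop
        rw [lintegral_prod _ m2.aemeasurable]
        calc ∫⁻ θ', ∫⁻ x, g₁ (x, h, θ, θ') ∂B.noise ∂(κ h)
            = ∫⁻ x, ∫⁻ θ', g₁ (x, h, θ, θ') ∂(κ h) ∂B.noise :=
              lintegral_lintegral_swap m4.aemeasurable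
          _ = _ := lintegral_congr fun x => (lintegral_prod _ (m3 x).aemeasurable).symm
    _ = ∫⁻ a, g a ∂(P.map H ⊗ₘ η) := (Measure.lintegral_compProd hg).symm

end IsThompsonSampling

end Bandit
end CompressedTS

/-! ### The proposition. -/

open CompressedTS

theorem mainTheorem2
    {𝒜 𝒪 Ξ Ω : Type*}
    [MeasurableSpace 𝒜] [StandardBorelSpace 𝒜] [Nonempty 𝒜]
    [MeasurableSpace 𝒪] [StandardBorelSpace 𝒪] [Nonempty 𝒪]
    [MeasurableSpace Ξ] [MeasurableSpace Ω]
    (B : CompressedTS.Bandit 𝒜 𝒪 Ξ)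
    (P : Measure Ω) [IsProbabilityMeasure P]
    {T : ℕ} (Θ : Ω → 𝒪) (Θhat : Fin T → Ω → 𝒪) (ξ : Fin T → Ω → Ξ)
    (hTS : B.IsThompsonSampling P Θ Θhat ξ)
    {K : ℕ} [NeZero K] (cell : 𝒜 → Fin K) (ε : ℝ) (hcell : B.IsEpsPartition cell ε)
    (t : Fin T)
    -- the regret of round `t` is well defined: `R(A⋆)` and `R(A_t)` are integrable
    (hopt : Integrable (fun ω => B.reward (B.optAction (Θ ω)) (Θ ω) (ξ t ω)) P)
    (hact : Integrable (fun ω => B.reward (B.optAction (Θhat t ω)) (Θ ω) (ξ t ω)) P) :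
    let H := B.history Θ Θhat ξ t
    -- the optimal action, its statistic, the Thompson Sampling action, and its statistic
    let Astar : Ω → 𝒜 := fun ω => B.optAction (Θ ω)
    let Aeps : Ω → Fin K := fun ω => cell (Astar ω)
    let Ahat : Ω → 𝒜 := fun ω => B.optAction (Θhat t ω)
    let AhatEps : Ω → Fin K := fun ω => cell (Ahat ω)
    -- `R(A)` for a random action `A` played at round `t`
    let R : (Ω → 𝒜) → Ω → ℝ := fun A ω => B.reward (A ω) (Θ ω) (ξ t ω)
    -- the probability space extended by an independent uniform seed, and `H`, `Aeps`, `R` on it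
    let P' : Measure (Ω × unitInterval) := P.prod volume
    let H' : Ω × unitInterval → Fin (t : ℕ) → 𝒜 × ℝ := fun p => H p.1
    let Aeps' : Ω × unitInterval → Fin K := fun p => Aeps p.1
    let R' : (Ω × unitInterval → 𝒜) → Ω × unitInterval → ℝ :=
      fun A p => B.reward (A p) (Θ p.1) (ξ t p.1)
    -- `φ h u` is the random function `φ_t` when the history is `h` and the seed is `u`
    ∃ φ : (Fin (t : ℕ) → 𝒜 × ℝ) → unitInterval → Fin K → 𝒜,
      Measurable (fun q : (Fin (t : ℕ) → 𝒜 × ℝ) × unitInterval × Fin K => φ q.1 q.2.1 q.2.2) ∧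
      let Atilde : Ω × unitInterval → 𝒜 := fun p => φ (H p.1) p.2 (Aeps p.1)
      let AtildeEps : Ω × unitInterval → 𝒜 := fun p => φ (H p.1) p.2 (AhatEps p.1)
      ∀ᵐ h ∂(P.map H),
        condDistrib Aeps H P h = condDistrib AhatEps H P h ∧
        CompressedTS.CondIntegrable P' H' (R' Atilde) h ∧
        CompressedTS.CondIntegrable P' H' (R' AtildeEps) h ∧
        CompressedTS.condMean P H (fun ω => R Astar ω - R Ahat ω) h ≤
          ε + CompressedTS.condMean P' H' (fun p => R' Atilde p - R' AtildeEps p) h ∧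
        CompressedTS.condMutualInfo P' H' Aeps' (fun p => (AtildeEps p, R' AtildeEps p)) h ≤
          CompressedTS.condMutualInfo P H Aeps (fun ω => (Ahat ω, R Ahat ω)) h := by
  intro H Astar Aeps Ahat AhatEps R P' H' Aeps' R'
  have := B.noise_prob
  have hπ := B.measurable_optAction
  have hr := B.measurable_reward
  have hc : Measurable cell := hcell.1
  have hH : Measurable H := hTS.measurable_history t
  have hΘ := hTS.measurable_param
  have hE := hTS.measurable_estimate t
  have hξ := hTS.measurable_noise t
  let κ := condDistrib Θ H P
  -- This is `roundLaw` as a kernel in the history, which supplies the measurability needed for a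
  -- disintegration.
  let η : Kernel (Fin (t : ℕ) → 𝒜 × ℝ) (𝒪 × Ξ × 𝒪 × unitInterval) :=
    κ ×ₖ (Kernel.const _ B.noise ×ₖ (κ ×ₖ Kernel.const _ volume))
  have hη (h) : η h = roundLaw (κ h) B.noise := by
    simp only [η, roundLaw, Kernel.prod_apply, Kernel.const_apply]
  let Z : Ω × unitInterval → 𝒪 × Ξ × 𝒪 × unitInterval :=
    fun p => (Θ p.1, ξ t p.1, Θhat t p.1, p.2)
  have hZ : Measurable Z := by fun_prop
  have hjoint : P'.map (fun p => (H p.1, Z p)) = P.map H ⊗ₘ η := hTS.map_history_round t η hη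
  obtain ⟨φ, hφ, hlaw⟩ := exists_resampling κ hπ hc
  refine ⟨φ, hφ, ?_⟩
  intro Atilde AtildeEps
  -- the actions and their rewards as functions of the history and of the variables of the round
  let aOpt : HistorySpace 𝒜 t → RoundSpace 𝒪 Ξ → 𝒜 := fun _ z => B.optAction z.1
  let aHat : HistorySpace 𝒜 t → RoundSpace 𝒪 Ξ → 𝒜 := fun _ z => B.optAction z.2.2.1
  let aRes : HistorySpace 𝒜 t → RoundSpace 𝒪 Ξ → 𝒜 :=
    fun h z => φ h z.2.2.2 (cell (B.optAction z.1))
  let aHatRes : HistorySpace 𝒜 t → RoundSpace 𝒪 Ξ → 𝒜 :=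
    fun h z => φ h z.2.2.2 (cell (B.optAction z.2.2.1))
  let rew : (HistorySpace 𝒜 t → RoundSpace 𝒪 Ξ → 𝒜) → HistorySpace 𝒜 t → RoundSpace 𝒪 Ξ → ℝ :=
    fun a h z => B.reward (a h z) z.1 z.2.1
  have hOpt : Measurable fun p : HistorySpace 𝒜 t × RoundSpace 𝒪 Ξ => aOpt p.1 p.2 := by fun_prop
  have hHat : Measurable fun p : HistorySpace 𝒜 t × RoundSpace 𝒪 Ξ => aHat p.1 p.2 := by fun_prop
  have hRes : Measurable fun p : HistorySpace 𝒜 t × RoundSpace 𝒪 Ξ => aRes p.1 p.2 :=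
    hφ.comp (f := fun p : HistorySpace 𝒜 t × RoundSpace 𝒪 Ξ =>
      (p.1, p.2.2.2.2, cell (B.optAction p.2.1))) (by fun_prop)
  have hHatRes : Measurable fun p : HistorySpace 𝒜 t × RoundSpace 𝒪 Ξ => aHatRes p.1 p.2 :=
    hφ.comp (f := fun p : HistorySpace 𝒜 t × RoundSpace 𝒪 Ξ =>
      (p.1, p.2.2.2.2, cell (B.optAction p.2.2.2.1))) (by fun_prop)
  have hrew {a : HistorySpace 𝒜 t → RoundSpace 𝒪 Ξ → 𝒜}
      (ha : Measurable fun p : HistorySpace 𝒜 t × RoundSpace 𝒪 Ξ => a p.1 p.2) :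
      Measurable fun p : HistorySpace 𝒜 t × RoundSpace 𝒪 Ξ => rew a p.1 p.2 :=
    hr.comp (ha.prodMk (by fun_prop :
      Measurable fun p : HistorySpace 𝒜 t × RoundSpace 𝒪 Ξ => (p.2.1, p.2.2.1)))
  have hrew' {a : HistorySpace 𝒜 t → RoundSpace 𝒪 Ξ → 𝒜}
      (ha : Measurable fun p : HistorySpace 𝒜 t × RoundSpace 𝒪 Ξ => a p.1 p.2)
      (h : HistorySpace 𝒜 t) : Measurable (rew a h) :=
    (hrew ha).comp measurable_prodMk_left
  -- Integrability under `P` passes to almost every fibre of the disintegration.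
  have hint {a : HistorySpace 𝒜 t → RoundSpace 𝒪 Ξ → 𝒜}
      (ha : Measurable fun p : HistorySpace 𝒜 t × RoundSpace 𝒪 Ξ => a p.1 p.2)
      {A : Ω → 𝒜} (hA : ∀ p : Ω × unitInterval, a (H p.1) (Z p) = A p.1)
      (hi : Integrable (R A) P) :
      ∀ᵐ h ∂(P.map H), Integrable (rew a h) (roundLaw (κ h) B.noise) := by
    have h1 : Integrable (fun q : HistorySpace 𝒜 t × RoundSpace 𝒪 Ξ => rew a q.1 q.2)
        (P.map H ⊗ₘ η) := by
      rw [← hjoint,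
        integrable_map_measure (hrew ha).aestronglyMeasurable
          (by fun_prop : Measurable fun p => (H p.1, Z p)).aemeasurable]
      have e : (fun q : HistorySpace 𝒜 t × RoundSpace 𝒪 Ξ => rew a q.1 q.2)
            ∘ (fun p => (H p.1, Z p))
          = fun p : Ω × unitInterval => R A p.1 := by
        funext p
        change B.reward (a (H p.1) (Z p)) (Θ p.1) (ξ t p.1) = _
        rw [hA]
      rw [e]
      exact hi.comp_fst _
    filter_upwards [((Measure.integrable_compProd_iff h1.aestronglyMeasurable).1 h1).1] with h hh
    rwa [hη] at hh
  have hAstar : Measurable Astar := by fun_prop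
  have hAhat : Measurable Ahat := by fun_prop
  have hR {A : Ω → 𝒜} (hA : Measurable A) : Measurable (R A) :=
    hr.comp (hA.prodMk (hΘ.prodMk hξ))
  have hcOpt : Measurable fun p : HistorySpace 𝒜 t × RoundSpace 𝒪 Ξ => cell (aOpt p.1 p.2) :=
    hc.comp hOpt
  have hHatPair := hHat.prodMk (hrew hHat)
  have hHatResPair := hHatRes.prodMk (hrew hHatRes)
  have hYpair : Measurable fun ω => (Ahat ω, R Ahat ω) := hAhat.prodMk (hR hAhat)
  -- Beyond this point the history is fixed and every conditional law is an image of `roundLaw (κ h)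
  -- B.noise`.
  filter_upwards [hint (A := Astar) hOpt (fun _ => rfl) hopt,
    hint (A := Ahat) hHat (fun _ => rfl) hact,
    condDistrib_ae_eq_map_of_prod hH hZ hjoint
      (f := fun h z => cell (aOpt h z)) (Y := Aeps) hcOpt (hc.comp hAstar) (fun _ => rfl),
    condDistrib_ae_eq_map_of_prod hH hZ hjoint
      (f := fun h z => cell (aHat h z)) (Y := AhatEps) (hc.comp hHat) (hc.comp hAhat) (fun _ => rfl),
    condDistrib_prod_ae_eq_map hH hZ hjoint (f := rew aRes) (hrew hRes),
    condDistrib_prod_ae_eq_map hH hZ hjoint (f := rew aHatRes) (hrew hHatRes),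
    condDistrib_ae_eq_map_of_prod hH hZ hjoint (f := fun h z => rew aOpt h z - rew aHat h z)
      (Y := fun ω => R Astar ω - R Ahat ω) ((hrew hOpt).sub (hrew hHat))
      ((hR hAstar).sub (hR hAhat)) (fun _ => rfl),
    condDistrib_prod_ae_eq_map hH hZ hjoint
      (f := fun h z => rew aRes h z - rew aHatRes h z) ((hrew hRes).sub (hrew hHatRes)),
    condDistrib_prod_ae_eq_map hH hZ hjoint (f := fun h z => cell (aOpt h z)) hcOpt,
    condDistrib_prod_ae_eq_map hH hZ hjoint
      (f := fun h z => (aHatRes h z, rew aHatRes h z)) hHatResPair,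
    condDistrib_prod_ae_eq_map hH hZ hjoint
      (f := fun h z => (cell (aOpt h z), (aHatRes h z, rew aHatRes h z)))
      (hcOpt.prodMk hHatResPair),
    condDistrib_ae_eq_map_of_prod hH hZ hjoint
      (f := fun h z => (aHat h z, rew aHat h z))
      (Y := fun ω => (Ahat ω, R Ahat ω)) hHatPair hYpair (fun _ => rfl),
    condDistrib_ae_eq_map_of_prod hH hZ hjoint
      (f := fun h z => (cell (aOpt h z), (aHat h z, rew aHat h z)))
      (Y := fun ω => (Aeps ω, (Ahat ω, R Ahat ω))) (hcOpt.prodMk hHatPair)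
      ((hc.comp hAstar).prodMk hYpair) (fun _ => rfl)]
    with h iOpt iHat lEps lHatEps lRes lHatRes lReg lRegRes lEps' lPairRes lJointRes lPair lJoint
  rw [hη] at lEps lHatEps lRes lHatRes lReg lRegRes lEps' lPairRes lJointRes lPair lJoint
  have hψ : Measurable fun q : unitInterval × Fin K => φ h q.1 q.2 :=
    hφ.comp measurable_prodMk_left
  let ρ := roundLaw (κ h) B.noise
  have mRew : Measurable fun w : 𝒪 × Ξ × 𝒜 => B.reward w.2.2 w.1 w.2.1 :=
    hr.comp (f := fun w : 𝒪 × Ξ × 𝒜 => (w.2.2, w.1, w.2.1)) (by fun_prop)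
  have tRew : ρ.map (rew aHatRes h) = ρ.map (rew aHat h) :=
    roundLaw_map_resampled hπ hc hψ (hlaw h) mRew
  have sOpt := hrew' hOpt h
  have sHat := hrew' hHat h
  have sRes := hrew' hRes h
  have sHatRes := hrew' hHatRes h
  have iHatRes : Integrable (rew aHatRes h) ρ := by
    have e : Integrable (fun x : ℝ => x) (ρ.map (rew aHat h)) :=
      (integrable_map_measure (by fun_prop) sHat.aemeasurable).2 iHat
    rw [← tRew] at e
    exact (integrable_map_measure (by fun_prop) sHatRes.aemeasurable).1 e
  have iRes : Integrable (rew aRes h) ρ :=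
    integrable_resampled_optimal hπ hc hψ hr iHatRes
  refine ⟨?_, ?_, ?_, ?_, ?_⟩
  · rw [lEps, lHatEps]
    have m : Measurable fun θ => cell (B.optAction θ) := hc.comp hπ
    change ρ.map ((fun θ => cell (B.optAction θ)) ∘ fun z => z.1)
      = ρ.map ((fun θ => cell (B.optAction θ)) ∘ fun z => z.2.2.1)
    rw [← Measure.map_map m (by fun_prop), ← Measure.map_map m (by fun_prop),
      roundLaw_map_param, roundLaw_map_estimate]
  · change Integrable (fun x : ℝ => x) (condDistrib (fun p => rew aRes (H' p) (Z p)) H' P' h)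
    rw [lRes]
    exact (integrable_map_measure (by fun_prop) sRes.aemeasurable).2 iRes
  · change Integrable (fun x : ℝ => x) (condDistrib (fun p => rew aHatRes (H' p) (Z p)) H' P' h)
    rw [lHatRes]
    exact (integrable_map_measure (by fun_prop) sHatRes.aemeasurable).2 iHatRes
  · change ∫ x, x ∂(condDistrib (fun ω => R Astar ω - R Ahat ω) H P h) ≤
      ε + ∫ x, x ∂(condDistrib (fun p => rew aRes (H' p) (Z p) - rew aHatRes (H' p) (Z p)) H' P' h)
    have d {f g : RoundSpace 𝒪 Ξ → ℝ} (hf : Measurable f) (hg : Measurable g)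
        (hfi : Integrable f ρ) (hgi : Integrable g ρ) :
        ∫ x, x ∂(ρ.map fun z => f z - g z) = ∫ z, f z ∂ρ - ∫ z, g z ∂ρ :=
      (integral_map (φ := fun z => f z - g z) (f := fun x : ℝ => x) (hf.sub hg).aemeasurable
        (by fun_prop)).trans (integral_sub hfi hgi)
    rw [lReg, lRegRes, d sOpt sHat iOpt iHat, d sRes sHatRes iRes iHatRes]
    -- The two Thompson terms cancel, leaving only the cost of replacing the optimal action.
    have e : ∫ z, rew aHatRes h z ∂ρ = ∫ z, rew aHat h z ∂ρ := by
      rw [← integral_map (f := fun x : ℝ => x) sHatRes.aemeasurable (by fun_prop), tRew,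
        integral_map sHat.aemeasurable (by fun_prop)]
    have := B.integral_sub_resampled_le hcell (κ h) hψ (hlaw h) iOpt iRes
    have e2 : ∫ z, rew aOpt h z ∂ρ - ∫ z, rew aRes h z ∂ρ ≤ ε := by
      rw [← integral_sub iOpt iRes]
      exact this
    linarith
  -- Both the joint laws and the two marginals agree, so the two divergences coincide.
  · refine le_of_eq ?_
    change InformationTheory.klDiv
        (condDistrib (fun p => (cell (aOpt (H' p) (Z p)),
          (aHatRes (H' p) (Z p), rew aHatRes (H' p) (Z p)))) H' P' h)
        ((condDistrib (fun p => cell (aOpt (H' p) (Z p))) H' P' h).prod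
          (condDistrib (fun p => (aHatRes (H' p) (Z p), rew aHatRes (H' p) (Z p))) H' P' h))
      = InformationTheory.klDiv (condDistrib (fun ω => (Aeps ω, (Ahat ω, R Ahat ω))) H P h)
        ((condDistrib Aeps H P h).prod (condDistrib (fun ω => (Ahat ω, R Ahat ω)) H P h))
    rw [lJointRes, lEps', lPairRes, lJoint, lEps, lPair]
    have t1 : ρ.map (fun z => (aHatRes h z, rew aHatRes h z))
        = ρ.map (fun z => (aHat h z, rew aHat h z)) :=
      roundLaw_map_resampled hπ hc hψ (hlaw h)
        (f := fun w => (w.2.2, B.reward w.2.2 w.1 w.2.1)) (by fun_prop)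
    have t2 : ρ.map (fun z => (cell (aOpt h z), (aHatRes h z, rew aHatRes h z)))
        = ρ.map (fun z => (cell (aOpt h z), (aHat h z, rew aHat h z))) :=
      roundLaw_map_resampled hπ hc hψ (hlaw h)
        (f := fun w => (cell (B.optAction w.1), (w.2.2, B.reward w.2.2 w.1 w.2.1)))
        (by fun_prop)
    exact congrArg₂ InformationTheory.klDiv t2 (congrArg _ t1)
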